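/- Let $N\ge 1$, $\delta=\pm1$, let $A,T\in\mathbb{C}^{2N\times 2N}$ be invertible matrices with $AT=TA$ and $T^2=\delta I_{2N}$, and let $C\in\mathbb{C}^{2N}$. For real $(x,t)$ put $$\varphi(x,t)=\exp\Big(\tfrac{i}{2}A^{2}x+\tfrac{i}{2}A^{-2}t\Big)C,\qquad \psi(x,t)=A\,T\,\varphi(-x,-t),$$ and define the $2N\times2N$ determinants (double Wronskians) $$f=\big|\partial_x\varphi,\partial_x^2\varphi,\dots,\partial_x^{N}\varphi;\ \psi,\partial_x\psi,\dots,\partial_x^{N-1}\psi\big|,\qquad g=\big|\varphi,\partial_x\varphi,\dots,\partial_x^{N}\varphi;\ \partial_x\psi,\dots,\partial_x^{N-1}\psi\big|.$$ Let $D_x,D_t$ be Hirota's operators, $D_x^mD_t^n\,F\cdot G=(\partial_x-\partial_{x'})^m(\partial_t-\partial_{t'})^nF(x,t)G(x',t')\big|_{x'=x,\,t'=t}$. (1) The functions $f,g$ are smooth on $\mathbb{R}^2$, the function $u=g/f$ is smooth wherever $f\ne0$, and $u$ solves the nonlocal Fokas–Lenells equation $$u_{xt}+u-2i\delta\,u\,u(-x,-t)\,u_x=0$$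 at every $(x,t)$ with $f(x,t)\neq0$ and $f(-x,-t)\ne0$. (2) For all real $(x,t)$, $$D_xD_t\,g(x,t)\cdot f(x,t)+g(x,t)f(x,t)=0,$$ $$D_xD_t\,f(x,t)\cdot f(-x,-t)+i\delta\,D_x\,g(x,t)\cdot g(-x,-t)=0,$$ $$D_t\,f(x,t)\cdot f(-x,-t)+i\delta\,g(x,t)\,g(-x,-t)=0.$$ (3) For all $K,H\in\mathbb{C}^{N\times N}$ and either square root $\sqrt\delta$ of $\delta$, the block diagonal matrices $T=\mathrm{diag}(\sqrt\delta\,I_N,-\sqrt\delta\,I_N)$ and $A=\mathrm{diag}(K,H)$ satisfy $AT=TA$ and $T^2=\delta I_{2N}$; $T$ is invertible, and $A$ is invertible when $K$ and $H$ are. -/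

import Mathlib

open scoped ContDiff

namespace FokasLenells

noncomputable section

/-- Partial derivative in `x` of a complex function of two real variables `(x, t)`. -/
def pdx (w : ℝ → ℝ → ℂ) (x t : ℝ) : ℂ := deriv (fun y => w y t) x

/-- Partial derivative in `t` of a complex function of two real variables `(x, t)`. -/
def pdt (w : ℝ → ℝ → ℂ) (x t : ℝ) : ℂ := deriv (fun y => w x y) t

/-- The operator `∂_x - ∂_{x'}` on functions of `(x, t, x', t')`. -/
def subX (H : ℝ → ℝ → ℝ → ℝ → ℂ) (x t x' t' : ℝ) : ℂ :=
  deriv (fun y => H y t x' t') x - deriv (fun y => H x t y t') x'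

/-- The operator `∂_t - ∂_{t'}` on functions of `(x, t, x', t')`. -/
def subT (H : ℝ → ℝ → ℝ → ℝ → ℂ) (x t x' t' : ℝ) : ℂ :=
  deriv (fun y => H x y x' t') t - deriv (fun y => H x t x' y) t'

/-- Hirota's bilinear operator
`D_x^m D_t^n F · G = (∂_x - ∂_{x'})^m (∂_t - ∂_{t'})^n F(x,t) G(x',t')` at `x' = x`, `t' = t`. -/
def hirota (m n : ℕ) (F G : ℝ → ℝ → ℂ) (x t : ℝ) : ℂ :=
  (subX^[m] (subT^[n] (fun y s y' s' => F y s * G y' s'))) x t x t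

/-- The double Wronskian `|p, p+1, …, p+a-1 ; q, q+1, …, q+(n-a)-1|` of two vector functions of
order `n`: the first `a` columns are `∂_x^p φ, …, ∂_x^{p+a-1} φ` and the remaining `n - a` columns
are `∂_x^q ψ, ∂_x^{q+1} ψ, …`. -/
def doubleWronskian {n : ℕ} (φ ψ : ℝ → ℝ → Fin n → ℂ) (a p q : ℕ) (x t : ℝ) : ℂ :=
  Matrix.det (Matrix.of fun i j : Fin n =>
    if (j : ℕ) < a then iteratedDeriv (p + (j : ℕ)) (fun y => φ y t i) x
    else iteratedDeriv (q + ((j : ℕ) - a)) (fun y => ψ y t i) x)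

/-- `f = |1, 2, …, N ; 0, 1, …, M-1|`. -/
def wronskianF (N M : ℕ) (φ ψ : ℝ → ℝ → Fin (N + M) → ℂ) : ℝ → ℝ → ℂ :=
  doubleWronskian φ ψ N 1 0

/-- `g = |0, 1, …, N ; 1, 2, …, M-1|` (for `M ≥ 1`). -/
def wronskianG (N M : ℕ) (φ ψ : ℝ → ℝ → Fin (N + M) → ℂ) : ℝ → ℝ → ℂ :=
  doubleWronskian φ ψ (N + 1) 0 1

/-- `φ(x,t) = exp((i/2) A² x + (i/2) A⁻² t) C`. -/
def phiVec {n : ℕ} (A : Matrix (Fin n) (Fin n) ℂ) (C : Fin n → ℂ) (x t : ℝ) : Fin n → ℂ :=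
  Matrix.mulVec
    (NormedSpace.exp
      ((Complex.I / 2 * (x : ℂ)) • A ^ 2 + (Complex.I / 2 * (t : ℂ)) • A⁻¹ ^ 2)) C

/-- `ψ(x,t) = A T φ(-x,-t)`. -/
def psiVec {n : ℕ} (A T : Matrix (Fin n) (Fin n) ℂ) (C : Fin n → ℂ) (x t : ℝ) : Fin n → ℂ :=
  Matrix.mulVec (A * T) (phiVec A C (-x) (-t))

/-- `f = |1, …, N ; 0, …, N-1|` for `φ` and `ψ(x,t) = A T φ(-x,-t)`. -/
def fSol (N : ℕ) (A T : Matrix (Fin (N + N)) (Fin (N + N)) ℂ) (C : Fin (N + N) → ℂ) :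
    ℝ → ℝ → ℂ :=
  wronskianF N N (phiVec A C) (psiVec A T C)

/-- `g = |0, …, N ; 1, …, N-1|` for `φ` and `ψ(x,t) = A T φ(-x,-t)`. -/
def gSol (N : ℕ) (A T : Matrix (Fin (N + N)) (Fin (N + N)) ℂ) (C : Fin (N + N) → ℂ) :
    ℝ → ℝ → ℂ :=
  wronskianG N N (phiVec A C) (psiVec A T C)

/-- `u = g / f`; meaningful at the points where `f` does not vanish. -/
def uSol (N : ℕ) (A T : Matrix (Fin (N + N)) (Fin (N + N)) ℂ) (C : Fin (N + N) → ℂ)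
    (x t : ℝ) : ℂ :=
  gSol N A T C x t / fSol N A T C x t

/-- The space-time reversed function `(x,t) ↦ w(-x,-t)`. -/
def reversed (w : ℝ → ℝ → ℂ) (x t : ℝ) : ℂ := w (-x) (-t)

/-- The `2N × 2N` matrix `diag(P, Q)` with `N × N` blocks `P` and `Q`. -/
def blockDiag {N : ℕ} (P Q : Matrix (Fin N) (Fin N) ℂ) :
    Matrix (Fin (N + N)) (Fin (N + N)) ℂ :=
  Matrix.reindex finSumFinEquiv finSumFinEquiv (Matrix.fromBlocks P 0 0 Q)

end

end FokasLenells

open FokasLenells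

open FokasLenells

namespace FokasLenells

open ExteriorAlgebra

/-! Write X = (i/2)A² and Y = (i/2)A⁻². Differentiation in x acts on φ as X and on ψ as -X, and 4Y
is the inverse of -X. Factoring exp(-xX + tY) out of every column leaves columns p_k depending on x
alone and q_k depending on t alone, with p_k' = 2 p_{k+1} and q_{k+1}' = -q_k/2. The factor costs
only its determinant, a product of exponentials in x and t, under which the bilinear equations are
invariant (`doubleWronskian_eq_gauge`, `BilinearSystem.gauge`).

The reversal (x,t) → (-x,-t) exchanges φ and ψ up to the constant matrix T A⁻¹, a factor X and
scalars. Hence, with N = m + 1, the reversed functions are, up to constants and the same gauge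
factor, again double Wronskians h = |p_0 … p_m; q_1 … q_{m+1}| and k = |p_1 … p_m; q_0 … q_{m+1}| in
the same columns (`doubleWronskian_reversed`, `vol_reversal`).

Each of f, g, h, k shares the columns p_1 … p_m, q_2 … q_{m+1} and so is, up to sign, an
antisymmetric pairing of the two remaining columns; so are the derivatives that enter the exchange
identities. Those identities are therefore three-term Plücker relations (`plucker_ιMulti`,
`bilinearSystem_wedge`). The equation for g and f alone needs an auxiliary determinant l = |p_1 …
p_{m+2}; q_2 … q_{m+1}|, eliminated through `lower_bilinear` and `hirota_eq_of_exchange`. The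
nonlocal equation then follows from the quotient rule (`BilinearSystem.quotient`). -/

/-- Vectors with `n` complex coordinates. -/
abbrev Vec (n : ℕ) := Fin n → ℂ

/-- The exterior algebra of `ℂⁿ`. -/
abbrev Ext (n : ℕ) := ExteriorAlgebra ℂ (Vec n)

/-! ### Top-degree functional and the Plücker relation -/

/-- The linear functional on the exterior algebra of `ℂⁿ` which is the determinant in degree `n`
and zero in the other degrees. -/
noncomputable def vol (n : ℕ) : Ext n →ₗ[ℂ] ℂ :=
  liftAlternating (Pi.single n Matrix.detRowAlternating)

theorem vol_ιMulti {n : ℕ} (v : Fin n → Vec n) : vol n (ιMulti ℂ n v) =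
    Matrix.det (Matrix.of v) := by
  rw [vol, liftAlternating_apply_ιMulti, Pi.single_eq_same]
  rfl

theorem vol_ιMulti_of_ne {n m : ℕ} (h : m ≠ n) (v : Fin m → Vec n) :
    vol n (ιMulti ℂ m v) = 0 := by
  rw [vol, liftAlternating_apply_ιMulti, Pi.single_eq_of_ne h]
  rfl

/-- Pulls a matrix acting on all columns out of a determinant; the gauge, the index shift and the
reversal all rest on this. -/
theorem vol_map {n : ℕ} (M : Matrix (Fin n) (Fin n) ℂ) (X : Ext n) :
    vol n (ExteriorAlgebra.map M.mulVecLin X) = M.det * vol n X := by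
  have : (vol n) ∘ₗ (ExteriorAlgebra.map M.mulVecLin).toLinearMap = M.det • vol n := by
    refine lhom_ext fun i => AlternatingMap.ext fun v => ?_
    simp only [LinearMap.compAlternatingMap_apply, LinearMap.comp_apply, AlgHom.toLinearMap_apply,
      map_apply_ιMulti, LinearMap.smul_apply, smul_eq_mul]
    by_cases h : i = n
    · subst h
      rw [vol_ιMulti, vol_ιMulti, ← Matrix.det_transpose M, mul_comm, ← Matrix.det_mul]
      congr 1
      ext j k
      simp [Matrix.mul_apply, Matrix.mulVec, dotProduct, mul_comm]
    · rw [vol_ιMulti_of_ne h, vol_ιMulti_of_ne h, mul_zero]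
  exact LinearMap.congr_fun this X

theorem ι_swap {n : ℕ} (x y : Vec n) : ι ℂ x * ι ℂ y = -(ι ℂ y * ι ℂ x) :=
  eq_neg_of_add_eq_zero_left (ι_add_mul_swap x y)

theorem ι_mul_ι_comm {n : ℕ} (x y : Vec n) (X : Ext n) :
    X * (ι ℂ x * ι ℂ y) = ι ℂ x * ι ℂ y * X := by
  induction X using ExteriorAlgebra.induction with
  | algebraMap r => exact Algebra.commutes _ _
  | ι z => rw [← mul_assoc, ι_swap z x, neg_mul, mul_assoc, ι_swap z y, mul_neg, neg_neg, mul_assoc]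
  | mul a b ha hb => rw [mul_assoc, hb, ← mul_assoc, ha, mul_assoc]
  | add a b ha hb => rw [add_mul, ha, hb, mul_add]

/-- The three-term Plücker relation. -/
theorem plucker_ιMulti {n m : ℕ} (u : Fin m → Vec n) (x y z w : Vec n) :
    vol n (ι ℂ x * ι ℂ y * ιMulti ℂ m u) * vol n (ι ℂ z * ι ℂ w * ιMulti ℂ m u)
      - vol n (ι ℂ x * ι ℂ z * ιMulti ℂ m u) * vol n (ι ℂ y * ι ℂ w * ιMulti ℂ m u)
      + vol n (ι ℂ x * ι ℂ w * ιMulti ℂ m u) * vol n (ι ℂ y * ι ℂ z * ιMulti ℂ m u) = 0 := by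
  have key : ∀ a b : Vec n, ι ℂ a * ι ℂ b * ιMulti ℂ m u
      = ιMulti ℂ (m + 2) (Matrix.vecCons a (Matrix.vecCons b u)) := by
    intro a b
    rw [ιMulti_succ_apply, ιMulti_succ_apply, mul_assoc]
    rfl
  simp only [key]
  by_cases h : m + 2 = n
  · subst h
    simp only [vol_ιMulti]
    set B : Vec (m + 2) → Vec (m + 2) → ℂ := fun a b =>
      Matrix.det (Matrix.of (Matrix.vecCons a (Matrix.vecCons b u))) with hB
    have swap : ∀ a b, B a b = - B b a := by
      intro a b
      have := congrArg (vol (m + 2)) (congrArg (· * ιMulti ℂ m u) (ι_swap a b))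
      simp only [neg_mul, key, vol_ιMulti, map_neg] at this
      exact this
    have hlin : ∀ b, ∃ L : Vec (m + 2) →ₗ[ℂ] ℂ, ∀ a, L a = B a b := by
      intro b
      refine ⟨vol (m + 2) ∘ₗ LinearMap.mulRight ℂ (ι ℂ b * ιMulti ℂ m u) ∘ₗ ι ℂ, fun a => ?_⟩
      simp only [LinearMap.comp_apply, LinearMap.mulRight_apply, ← mul_assoc, key, vol_ιMulti, hB]
    obtain ⟨L, hL⟩ := hlin w
    have hz : ∀ i, B (u i) w = 0 := by
      intro i
      refine Matrix.det_zero_of_row_eq (i := 0) (j := i.succ.succ) (by simp [Fin.ext_iff]) ?_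
      ext k
      simp
    -- Cramer's rule expands z in x, y and the u i. Applying `B · w` kills every u i, and the two
    -- surviving Cramer coefficients are `B z y` and `B x z`.
    have hc := Matrix.mulVec_cramer (Matrix.of (Matrix.vecCons x (Matrix.vecCons y u))).transpose z
    have hc' : ∑ i, (Matrix.cramer (Matrix.of (Matrix.vecCons x (Matrix.vecCons y u))).transpose z i) •
        (Matrix.vecCons x (Matrix.vecCons y u) i) = B x y • z := by
      rw [Matrix.det_transpose] at hc
      rw [← hc]
      ext k
      simp [Matrix.mulVec, dotProduct, mul_comm]
    have hl := congrArg L hc'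
    simp only [Fin.sum_univ_succ, map_add, map_sum, map_smul, smul_eq_mul] at hl
    simp only [Matrix.cons_val_zero, Matrix.cons_val_succ, hL, hz, mul_zero, Finset.sum_const_zero,
      add_zero, Matrix.cramer_apply, Matrix.updateCol_transpose, Matrix.det_transpose] at hl
    have e1 : ((Matrix.of (Matrix.vecCons x (Matrix.vecCons y u))).updateRow 0 z).det = B z y := by
      rw [hB]; congr 1; ext i j
      refine Fin.cases ?_ (fun i => ?_) i <;> simp [Matrix.updateRow_apply]
    have e2 : ((Matrix.of (Matrix.vecCons x (Matrix.vecCons y u))).updateRow (Fin.succ 0) z).det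
        = B x z := by
      rw [hB]; congr 1; ext i j
      refine Fin.cases ?_ (fun i => Fin.cases ?_ (fun i => ?_) i) i <;>
        simp [Matrix.updateRow_apply, Fin.ext_iff]
    rw [e1, e2] at hl
    change B x y * B z w - B x z * B y w + B x w * B y z = 0
    rw [swap z y] at hl
    linear_combination -hl
  · simp only [vol_ιMulti_of_ne h]
    ring

/-! ### Wedges of consecutive columns -/

/-- The product `v_s ∧ v_{s+1} ∧ … ∧ v_{s+k-1}`. -/
noncomputable def wedge {n : ℕ} (v : ℕ → Vec n) (s k : ℕ) : Ext n :=
  ιMulti ℂ k fun i => v (s + i)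

@[simp] theorem wedge_zero {n : ℕ} (v : ℕ → Vec n) (s : ℕ) : wedge v s 0 = 1 := by
  simp [wedge]

theorem wedge_succ {n : ℕ} (v : ℕ → Vec n) (s k : ℕ) :
    wedge v s (k + 1) = wedge v s k * ι ℂ (v (s + k)) := by
  simp only [wedge, ιMulti_apply, List.ofFn_succ', List.prod_concat]
  rfl

theorem wedge_succ_left {n : ℕ} (v : ℕ → Vec n) (s k : ℕ) :
    wedge v s (k + 1) = ι ℂ (v s) * wedge v (s + 1) k := by
  simp only [wedge, ιMulti_apply, List.ofFn_succ, List.prod_cons]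
  simp [add_assoc, add_comm 1]

theorem ι_mul_wedge {n : ℕ} (x : Vec n) (v : ℕ → Vec n) (s k : ℕ) :
    ι ℂ x * wedge v s k = (-1 : ℂ) ^ k • (wedge v s k * ι ℂ x) := by
  induction k with
  | zero => simp
  | succ k ih =>
    rw [wedge_succ, ← mul_assoc, ih, smul_mul_assoc, mul_assoc, ι_swap x, pow_succ]
    simp [mul_assoc]

theorem map_wedge {n : ℕ} (M : Matrix (Fin n) (Fin n) ℂ) (v : ℕ → Vec n) (s k : ℕ) :
    ExteriorAlgebra.map M.mulVecLin (wedge v s k) = wedge (fun i => M.mulVec (v i)) s k := by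
  simp only [wedge, map_apply_ιMulti]
  rfl

theorem wedge_shift {n : ℕ} (v : ℕ → Vec n) (s k : ℕ) :
    wedge (fun i => v (i + 1)) s k = wedge v (s + 1) k := by
  simp only [wedge, add_right_comm]

theorem wedge_smul {n : ℕ} (c : ℕ → ℂ) (v : ℕ → Vec n) (s k : ℕ) :
    wedge (fun i => c i • v i) s k = (∏ i ∈ Finset.range k, c (s + i)) • wedge v s k := by
  induction k with
  | zero => simp
  | succ k ih => simp [wedge_succ, ih, Finset.prod_range_succ, smul_smul, mul_comm]

theorem wedge_mul_wedge_comm {n : ℕ} (v w : ℕ → Vec n) (s k r l : ℕ) :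
    wedge v s k * wedge w r l = (-1 : ℂ) ^ (k * l) • (wedge w r l * wedge v s k) := by
  induction k with
  | zero => simp
  | succ k ih =>
    rw [wedge_succ, mul_assoc, ι_mul_wedge, mul_smul_comm, ← mul_assoc, ih, smul_mul_assoc,
      smul_smul, mul_assoc, ← pow_add]
    ring_nf

theorem plucker {n : ℕ} (v w : ℕ → Vec n) (s k r l : ℕ) (x y z z' : Vec n) :
    vol n (ι ℂ x * ι ℂ y * (wedge v s k * wedge w r l))
        * vol n (ι ℂ z * ι ℂ z' * (wedge v s k * wedge w r l))
      - vol n (ι ℂ x * ι ℂ z * (wedge v s k * wedge w r l))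
        * vol n (ι ℂ y * ι ℂ z' * (wedge v s k * wedge w r l))
      + vol n (ι ℂ x * ι ℂ z' * (wedge v s k * wedge w r l))
        * vol n (ι ℂ y * ι ℂ z * (wedge v s k * wedge w r l)) = 0 := by
  simp only [wedge, ιMulti_mul_ιMulti]
  exact plucker_ιMulti _ x y z z'

/-! ### Differentiation in the exterior algebra -/

/-- Differentiability of a curve in the exterior algebra, tested against linear functionals. -/
def HasWeakDerivAt {n : ℕ} (X : ℝ → Ext n) (X' : Ext n) (t : ℝ) : Prop :=
  ∀ L : Ext n →ₗ[ℂ] ℂ, HasDerivAt (fun s => L (X s)) (L X') t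

theorem hasWeakDerivAt_const {n : ℕ} (X : Ext n) (t : ℝ) : HasWeakDerivAt (fun _ => X) 0 t := by
  intro L
  simpa using hasDerivAt_const t (L X)

theorem HasWeakDerivAt.mul_ι {n : ℕ} {X : ℝ → Ext n} {X' : Ext n} {v : ℝ → Vec n} {v' : Vec n}
    {t : ℝ} (hX : HasWeakDerivAt X X' t) (hv : HasDerivAt v v' t) :
    HasWeakDerivAt (fun s => X s * ι ℂ (v s)) (X' * ι ℂ (v t) + X t * ι ℂ v') t := by
  intro L
  -- Expanding the vector factor in the standard basis reduces the claim to the scalar product rule,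
  -- with no norm on the exterior algebra.
  have expand : ∀ (Y : Ext n) (w : Vec n),
      L (Y * ι ℂ w) = ∑ i, w i * L (Y * ι ℂ (Pi.single i 1)) := by
    intro Y w
    conv_lhs => rw [pi_eq_sum_univ' w]
    simp [Finset.mul_sum]
  rw [map_add, expand X', expand (X t), ← Finset.sum_add_distrib,
    show (fun s => L (X s * ι ℂ (v s))) = _ from funext fun s => expand _ _]
  refine HasDerivAt.fun_sum fun i _ => ?_
  have h1 := (hasDerivAt_pi.1 hv i).mul
    (hX (L ∘ₗ LinearMap.mulRight ℂ (ι ℂ (Pi.single i (1 : ℂ)))))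
  simp only [LinearMap.comp_apply, LinearMap.mulRight_apply] at h1
  convert! h1 using 1
  ring

/-- In the Leibniz expansion every term but the last has a repeated factor. -/
theorem hasWeakDerivAt_wedge_raise {n : ℕ} {p : ℝ → ℕ → Vec n} {c : ℂ} {x : ℝ}
    (hp : ∀ k, HasDerivAt (fun y => p y k) (c • p x (k + 1)) x) (s m : ℕ) :
    HasWeakDerivAt (fun y => wedge (p y) s (m + 1))
      (c • (wedge (p x) s m * ι ℂ (p x (s + m + 1)))) x := by
  induction m with
  | zero =>
    have := (hasWeakDerivAt_const (1 : Ext n) x).mul_ι (hp s)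
    simpa [wedge_succ] using this
  | succ m ih =>
    have := ih.mul_ι (hp (s + (m + 1)))
    simp only [wedge_succ (p _) s (m + 1)]
    convert! this using 1
    simp [mul_assoc, add_assoc]

/-- Lowering an index repeats the preceding factor, so only the term for the first factor survives.
-/
theorem hasWeakDerivAt_wedge_lower {n : ℕ} {q : ℝ → ℕ → Vec n} {c : ℂ} {t : ℝ}
    (hq : ∀ k, HasDerivAt (fun y => q y (k + 1)) (c • q t k) t) (s m : ℕ) :
    HasWeakDerivAt (fun y => wedge (q y) (s + 1) (m + 1))
      (c • (ι ℂ (q t s) * wedge (q t) (s + 2) m)) t := by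
  induction m with
  | zero =>
    have := (hasWeakDerivAt_const (1 : Ext n) t).mul_ι (hq s)
    simpa [wedge_succ] using this
  | succ m ih =>
    have := ih.mul_ι (hq (s + (m + 1)))
    simp only [wedge_succ (q _) (s + 1) (m + 1)]
    have e : s + 1 + (m + 1) = s + (m + 1) + 1 := by ring
    rw [e]
    convert! this using 1
    rw [wedge_succ (q t) (s + 1) m, wedge_succ (q t) (s + 2) m]
    have e : s + 1 + m = s + (m + 1) := by ring
    have e' : s + 2 + m = s + (m + 1) + 1 := by ring
    rw [e, e']
    simp [mul_assoc]

/-- The derivative of `v_s ∧ … ∧ v_{s+k-1}` when `v_i' = v_{i+1}`. -/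
noncomputable def raise {n : ℕ} (v : ℕ → Vec n) (s : ℕ) : ℕ → Ext n
  | 0 => 0
  | m + 1 => wedge v s m * ι ℂ (v (s + m + 1))

/-- The derivative of `v_{s+1} ∧ … ∧ v_{s+k}` when `v_{i+1}' = v_i`. -/
noncomputable def lower {n : ℕ} (v : ℕ → Vec n) (s : ℕ) : ℕ → Ext n
  | 0 => 0
  | m + 1 => ι ℂ (v s) * wedge v (s + 2) m

theorem hasWeakDerivAt_raise {n : ℕ} {p : ℝ → ℕ → Vec n} {c : ℂ} {x : ℝ}
    (hp : ∀ k, HasDerivAt (fun y => p y k) (c • p x (k + 1)) x) (s m : ℕ) :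
    HasWeakDerivAt (fun y => wedge (p y) s m) (c • raise (p x) s m) x := by
  cases m with
  | zero => simpa [raise] using hasWeakDerivAt_const (1 : Ext n) x
  | succ m => exact hasWeakDerivAt_wedge_raise hp s m

theorem hasWeakDerivAt_lower {n : ℕ} {q : ℝ → ℕ → Vec n} {c : ℂ} {t : ℝ}
    (hq : ∀ k, HasDerivAt (fun y => q y (k + 1)) (c • q t k) t) (s m : ℕ) :
    HasWeakDerivAt (fun y => wedge (q y) (s + 1) m) (c • lower (q t) s m) t := by
  cases m with
  | zero => simpa [lower] using hasWeakDerivAt_const (1 : Ext n) t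
  | succ m => exact hasWeakDerivAt_wedge_lower hq s m

/-! ### Mixed partial derivatives and Hirota operators -/

/-- `w` has the partial derivatives `w_x = wx`, `w_t = wt` and `w_{xt} = w_{tx} = wxt`. -/
structure HasPartials (w wx wt wxt : ℝ → ℝ → ℂ) : Prop where
  x : ∀ x t, HasDerivAt (fun y => w y t) (wx x t) x
  t : ∀ x t, HasDerivAt (fun s => w x s) (wt x t) t
  xt : ∀ x t, HasDerivAt (fun s => wx x s) (wxt x t) t
  tx : ∀ x t, HasDerivAt (fun y => wt y t) (wxt x t) x

theorem HasWeakDerivAt.vol_mul_const {n : ℕ} {U : ℝ → Ext n} {U' : Ext n} {x : ℝ}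
    (hU : HasWeakDerivAt U U' x) (Y : Ext n) :
    HasDerivAt (fun y => vol n (U y * Y)) (vol n (U' * Y)) x :=
  hU (vol n ∘ₗ LinearMap.mulRight ℂ Y)

/-- This is the gain from the gauge: one factor sees only x and the other only t, so both mixed
derivatives exist and agree. -/
theorem HasPartials.vol_mul {n : ℕ} {U U' V V' : ℝ → Ext n}
    (hU : ∀ x, HasWeakDerivAt U (U' x) x) (hV : ∀ t, HasWeakDerivAt V (V' t) t) :
    HasPartials (fun x t => vol n (U x * V t)) (fun x t => vol n (U' x * V t))
      (fun x t => vol n (U x * V' t)) (fun x t => vol n (U' x * V' t)) where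
  x x t := hU x (vol n ∘ₗ LinearMap.mulRight ℂ (V t))
  t x t := hV t (vol n ∘ₗ LinearMap.mulLeft ℂ (U x))
  xt x t := hV t (vol n ∘ₗ LinearMap.mulLeft ℂ (U' x))
  tx x t := hU x (vol n ∘ₗ LinearMap.mulRight ℂ (V' t))

theorem HasPartials.const_mul {w wx wt wxt : ℝ → ℝ → ℂ} (h : HasPartials w wx wt wxt) (c : ℂ) :
    HasPartials (fun x t => c * w x t) (fun x t => c * wx x t) (fun x t => c * wt x t)
      (fun x t => c * wxt x t) where
  x x t := (h.x x t).const_mul c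
  t x t := (h.t x t).const_mul c
  xt x t := (h.xt x t).const_mul c
  tx x t := (h.tx x t).const_mul c

theorem HasPartials.gauge {w wx wt wxt : ℝ → ℝ → ℂ} (h : HasPartials w wx wt wxt)
    {d e : ℝ → ℂ} {α β : ℂ} (hd : ∀ x, HasDerivAt d (α * d x) x)
    (he : ∀ t, HasDerivAt e (β * e t) t) :
    HasPartials (fun x t => d x * e t * w x t)
      (fun x t => d x * e t * (α * w x t + wx x t))
      (fun x t => d x * e t * (β * w x t + wt x t))
      (fun x t => d x * e t * (α * β * w x t + α * wt x t + β * wx x t + wxt x t)) where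
  x x t := by
    convert! ((hd x).mul_const (e t)).mul (h.x x t) using 1
    ring
  t x t := by
    convert! ((he t).const_mul (d x)).mul (h.t x t) using 1
    ring
  xt x t := by
    convert! ((he t).const_mul (d x)).mul (((h.t x t).const_mul α).add (h.xt x t)) using 1
    simp only [Pi.add_apply]
    ring
  tx x t := by
    convert! ((hd x).mul_const (e t)).mul (((h.x x t).const_mul β).add (h.tx x t)) using 1
    simp only [Pi.add_apply]
    ring

theorem hirota_zero_one {F G Fx Ft Fxt Gx Gt Gxt : ℝ → ℝ → ℂ} (hF : HasPartials F Fx Ft Fxt)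
    (hG : HasPartials G Gx Gt Gxt) (x t : ℝ) :
    hirota 0 1 F G x t = Ft x t * G x t - F x t * Gt x t := by
  simp only [hirota, Function.iterate_zero, Function.iterate_one, id, subT]
  rw [((hF.t x t).mul_const _).deriv, ((hG.t x t).const_mul _).deriv]

theorem hirota_one_zero {F G Fx Gx : ℝ → ℝ → ℂ}
    (hF : ∀ x t, HasDerivAt (fun y => F y t) (Fx x t) x)
    (hG : ∀ x t, HasDerivAt (fun y => G y t) (Gx x t) x) (x t : ℝ) :
    hirota 1 0 F G x t = Fx x t * G x t - F x t * Gx x t := by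
  simp only [hirota, Function.iterate_zero, Function.iterate_one, id, subX]
  rw [((hF x t).mul_const _).deriv, ((hG x t).const_mul _).deriv]

theorem hirota_one_one {F G Fx Ft Fxt Gx Gt Gxt : ℝ → ℝ → ℂ} (hF : HasPartials F Fx Ft Fxt)
    (hG : HasPartials G Gx Gt Gxt) (x t : ℝ) :
    hirota 1 1 F G x t = Fxt x t * G x t - Fx x t * Gt x t - Ft x t * Gx x t
      + F x t * Gxt x t := by
  have hT : subT (fun y s y' s' => F y s * G y' s')
      = fun y s y' s' => Ft y s * G y' s' - F y s * Gt y' s' := by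
    funext y s y' s'
    rw [subT, ((hF.t y s).mul_const _).deriv, ((hG.t y' s').const_mul _).deriv]
  simp only [hirota, Function.iterate_one, hT, subX]
  rw [(((hF.tx x t).mul_const _).fun_sub ((hF.x x t).mul_const _)).deriv,
    (((hG.x x t).const_mul _).fun_sub ((hG.tx x t).const_mul _)).deriv]
  ring

/-! ### Determinants as pairings of two columns -/

theorem neg_one_pow_smul_smul {M : Type*} [AddCommGroup M] [Module ℂ M] (k : ℕ) (X : M) :
    (-1 : ℂ) ^ k • (-1 : ℂ) ^ k • X = X := by
  rw [smul_smul, ← mul_pow]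
  simp

theorem wedge_mul_ι {n : ℕ} (x : Vec n) (v : ℕ → Vec n) (s k : ℕ) :
    wedge v s k * ι ℂ x = (-1 : ℂ) ^ k • (ι ℂ x * wedge v s k) := by
  rw [ι_mul_wedge, neg_one_pow_smul_smul]

section Reorder

variable {n : ℕ} (p q : ℕ → Vec n) (s k r l : ℕ) (x y : Vec n)

/-- The determinant with columns `x`, `y`, `p_s, …, p_{s+k-1}`, `q_r, …, q_{r+l-1}`. -/
noncomputable def pairing : ℂ := vol n (ι ℂ x * ι ℂ y * (wedge p s k * wedge q r l))

theorem vol_inner_inner :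
    vol n (wedge p s k * ι ℂ x * (ι ℂ y * wedge q r l)) = pairing p q s k r l x y := by
  rw [pairing, ← mul_assoc (ι ℂ x * ι ℂ y), ← ι_mul_ι_comm]
  simp only [mul_assoc]

theorem vol_inner_inner_left :
    vol n (wedge p s k * ι ℂ x * ι ℂ y * wedge q r l) = pairing p q s k r l x y := by
  rw [← vol_inner_inner]
  simp only [mul_assoc]

theorem vol_inner_inner_right :
    vol n (wedge p s k * (ι ℂ x * (ι ℂ y * wedge q r l))) = pairing p q s k r l x y := by
  rw [← vol_inner_inner]
  simp only [mul_assoc]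

theorem vol_outer_inner :
    vol n (ι ℂ x * wedge p s k * (ι ℂ y * wedge q r l))
      = (-1) ^ k * pairing p q s k r l x y := by
  rw [ι_mul_wedge, smul_mul_assoc, map_smul, vol_inner_inner, smul_eq_mul]

theorem vol_outer_inner_left :
    vol n (ι ℂ x * (wedge p s k * ι ℂ y) * wedge q r l)
      = (-1) ^ k * pairing p q s k r l x y := by
  rw [← vol_outer_inner]
  simp only [mul_assoc]

theorem vol_inner_outer :
    vol n (wedge p s k * ι ℂ x * (wedge q r l * ι ℂ y))
      = (-1) ^ l * pairing p q s k r l x y := by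
  rw [wedge_mul_ι y, mul_smul_comm, map_smul, vol_inner_inner, smul_eq_mul]

theorem vol_inner_outer_right :
    vol n (wedge p s k * (ι ℂ x * (wedge q r l * ι ℂ y)))
      = (-1) ^ l * pairing p q s k r l x y := by
  rw [← vol_inner_outer]
  simp only [mul_assoc]

theorem pairing_plucker (z w : Vec n) :
    pairing p q s k r l x y * pairing p q s k r l z w
      - pairing p q s k r l x z * pairing p q s k r l y w
      + pairing p q s k r l x w * pairing p q s k r l y z = 0 :=
  plucker p q s k r l x y z w

theorem pairing_swap : pairing p q s k r l x y = -pairing p q s k r l y x := by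
  rw [pairing, ι_swap, neg_mul, map_neg, pairing]

end Reorder

/-! ### Shifting all indices by the generator -/

section Shift

variable {n : ℕ} {p q : ℕ → Vec n} {a : Matrix (Fin n) (Fin n) ℂ}

theorem map_wedge_of_succ {c : ℂ} (hp : ∀ k, a.mulVec (p k) = c • p (k + 1)) (s k : ℕ) :
    ExteriorAlgebra.map a.mulVecLin (wedge p s k) = c ^ k • wedge p (s + 1) k := by
  simp only [map_wedge, hp]
  rw [wedge_smul (fun _ => c), wedge_shift]
  simp

theorem vol_shift (hp : ∀ k, a.mulVec (p k) = p (k + 1)) (hq : ∀ k, a.mulVec (q k) = -q (k + 1))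
    (s k r l : ℕ) :
    vol n (wedge p (s + 1) k * wedge q (r + 1) l)
      = (-1) ^ l * (a.det * vol n (wedge p s k * wedge q r l)) := by
  have hp' : ∀ k, a.mulVec (p k) = (1 : ℂ) • p (k + 1) := by simpa using hp
  have hq' : ∀ k, a.mulVec (q k) = (-1 : ℂ) • q (k + 1) := by simpa using hq
  rw [← vol_map, map_mul (ExteriorAlgebra.map _), map_wedge_of_succ hp', map_wedge_of_succ hq',
    one_pow, one_smul, mul_smul_comm, map_smul, smul_eq_mul, ← mul_assoc, ← mul_pow]
  simp

end Shift

/-- The bilinear identity `H_t K - H K_t = G F / 2` between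
`H = |p_0 … p_m; q_1 … q_{m+1}|`, `K = |p_1 … p_{m+2}; q_2 … q_{m+1}|`,
`G = |p_0 … p_{m+1}; q_2 … q_{m+1}|` and `F = |p_1 … p_{m+1}; q_1 … q_{m+1}|`. -/
theorem lower_bilinear {n : ℕ} {p q : ℕ → Vec n} {a : Matrix (Fin n) (Fin n) ℂ}
    (hp : ∀ k, a.mulVec (p k) = p (k + 1)) (hq : ∀ k, a.mulVec (q k) = -q (k + 1)) (m : ℕ) :
    vol n (wedge p 0 (m + 1) * lower q 0 (m + 1)) * vol n (wedge p 1 (m + 2) * wedge q 2 m)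
      - vol n (wedge p 0 (m + 1) * wedge q 1 (m + 1)) * vol n (wedge p 1 (m + 2) * lower q 1 m)
      = - (vol n (wedge p 0 (m + 2) * wedge q 2 m)
        * vol n (wedge p 1 (m + 1) * wedge q 1 (m + 1))) := by
  have hp' : ∀ k, a.mulVec (p k) = (1 : ℂ) • p (k + 1) := by simpa using hp
  have hq' : ∀ k, a.mulVec (q k) = (-1 : ℂ) • q (k + 1) := by simpa using hq
  -- Pulling `a` out lowers the indices in the terms that start at p_1, so that all six determinants
  -- contain p_0 … p_m and become comparable.
  have e1 : vol n (wedge p 1 (m + 2) * wedge q 2 m)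
      = (-1) ^ m * (a.det * vol n (wedge p 0 (m + 2) * wedge q 1 m)) :=
    vol_shift hp hq 0 (m + 2) 1 m
  have e2 : vol n (wedge p 1 (m + 1) * wedge q 1 (m + 1))
      = (-1) ^ (m + 1) * (a.det * vol n (wedge p 0 (m + 1) * wedge q 0 (m + 1))) :=
    vol_shift hp hq 0 (m + 1) 0 (m + 1)
  rw [e1, e2]
  cases m with
  | zero => simp [lower, wedge_succ]; ring
  | succ m =>
    have e3 : vol n (wedge p 1 (m + 1 + 2) * lower q 1 (m + 1))
        = (-1) ^ (m + 1) * (a.det * vol n (wedge p 0 (m + 1 + 2) * (ι ℂ (q 0) * wedge q 2 m))) := by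
      rw [← vol_map, map_mul (ExteriorAlgebra.map _), map_mul (ExteriorAlgebra.map _),
        map_wedge_of_succ hp', map_wedge_of_succ hq', one_pow,
        one_smul, map_apply_ι, Matrix.mulVecLin_apply, hq, map_neg, neg_mul, mul_smul_comm,
        ← smul_neg, mul_smul_comm, map_smul, smul_eq_mul, mul_neg, map_neg, lower]
      have : ((-1 : ℂ) ^ m) ^ 2 = 1 := by rw [← pow_mul, mul_comm, pow_mul]; simp
      rw [pow_succ]
      linear_combination
        (-vol n (wedge p 1 (m + 1 + 2) * (ι ℂ (q 1) * wedge q 3 m))) * this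
    rw [e3]
    have l1 : lower q 0 (m + 1 + 1) = ι ℂ (q 0) * (wedge q 2 m * ι ℂ (q (2 + m))) := by
      rw [lower, wedge_succ]
    have l2 : wedge q 1 (m + 1 + 1) = ι ℂ (q 1) * (wedge q 2 m * ι ℂ (q (2 + m))) := by
      rw [wedge_succ_left, wedge_succ]
    have l3 : wedge q 0 (m + 1 + 1) = ι ℂ (q 0) * (ι ℂ (q 1) * wedge q 2 m) := by
      rw [wedge_succ_left, wedge_succ_left]
    have l4 : wedge q 1 (m + 1) = ι ℂ (q 1) * wedge q 2 m := wedge_succ_left q 1 m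
    rw [l1, l2, l3, l4, wedge_succ p 0 (m + 1 + 1), wedge_succ q 2 m,
      vol_inner_outer_right, vol_inner_outer_right, vol_inner_inner_right, vol_inner_inner,
      vol_inner_inner, vol_inner_outer]
    -- After the case split the common columns are p_0 … p_{m+1}, q_2 … q_{m+1}; the four exchanged
    -- ones are p_{m+2}, q_{m+2}, q_0, q_1.
    have hP := pairing_plucker p q 0 (m + 1 + 1) 2 m (p (0 + (m + 1 + 1))) (q (2 + m)) (q 0) (q 1)
    rw [pairing_swap p q 0 (m + 1 + 1) 2 m (q (2 + m)) (q 0),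
      pairing_swap p q 0 (m + 1 + 1) 2 m (q (2 + m)) (q 1)] at hP
    linear_combination ((-1) ^ m * (-1) ^ (m + 1 + 1) * a.det) * hP

/-! ### The bilinear system and its proof by Plücker relations -/

/-- The bilinear system `f_t h - f h_t = c g k`, `f_{xt} h - f_x h_t = c g_x k`,
`g_{xt} f - g_x f_t - g_t f_x + g f_{xt} + g f = 0` for functions with the partial derivatives
which occur in it. -/
def BilinearSystem (c : ℂ) (f g h k : ℝ → ℝ → ℂ) : Prop :=
  ∃ fx ft fxt gx gt gxt hx ht hxt kx : ℝ → ℝ → ℂ,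
    HasPartials f fx ft fxt ∧ HasPartials g gx gt gxt ∧ HasPartials h hx ht hxt ∧
    (∀ x t, HasDerivAt (fun y => k y t) (kx x t) x) ∧
    (∀ x t, ft x t * h x t - f x t * ht x t = c * (g x t * k x t)) ∧
    (∀ x t, fxt x t * h x t - fx x t * ht x t = c * (gx x t * k x t)) ∧
    (∀ x t, gxt x t * f x t - gx x t * ft x t - gt x t * fx x t + g x t * fxt x t
      + g x t * f x t = 0)

/-- The t-derivative of `h1`, subtracted from twice `h2`, turns the Hirota expression into -2(h_t l
- h l_t), which `h3` evaluates as -g f. -/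
theorem hirota_eq_of_exchange {f fx ft fxt g gx gt gxt h hx ht hxt l lx lt lxt : ℝ → ℝ → ℂ}
    (jf : HasPartials f fx ft fxt) (jg : HasPartials g gx gt gxt) (jh : HasPartials h hx ht hxt)
    (jl : HasPartials l lx lt lxt) {x t : ℝ}
    (h1 : ∀ s, g x s * fx x s - gx x s * f x s = -2 * (h x s * l x s))
    (h2 : g x t * fxt x t - gx x t * ft x t = -2 * (ht x t * l x t))
    (h3 : 2 * (ht x t * l x t - h x t * lt x t) = g x t * f x t) :
    gxt x t * f x t - gx x t * ft x t - gt x t * fx x t + g x t * fxt x t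
      + g x t * f x t = 0 := by
  have d1 := ((jg.t x t).mul (jf.xt x t)).sub ((jg.xt x t).mul (jf.t x t))
  have d2 := ((jh.t x t).mul (jl.t x t)).const_mul (-2 : ℂ)
  have d := d1.unique (d2.congr_of_eventuallyEq (Filter.Eventually.of_forall h1))
  linear_combination 2 * h2 - d - h3

section Tau

variable {n : ℕ} (p q : ℕ → Vec n) (m : ℕ)

theorem tauF_eq :
    vol n (wedge p 1 (m + 1) * wedge q 1 (m + 1))
    = pairing p q 1 m 2 m (p (1 + m)) (q 1) := by
  rw [wedge_succ, wedge_succ_left q, vol_inner_inner]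

/-- The sign comes from moving the column that follows p_0 to the left across p_1 … p_m. -/
theorem tauG_eq :
    vol n (wedge p 0 (m + 2) * wedge q 2 m)
    = (-1) ^ m * pairing p q 1 m 2 m (p 0) (p (1 + m)) := by
  rw [wedge_succ_left, wedge_succ, vol_outer_inner_left]

theorem tauH_eq :
    vol n (wedge p 0 (m + 1) * wedge q 1 (m + 1))
    = (-1) ^ m * pairing p q 1 m 2 m (p 0) (q 1) := by
  rw [wedge_succ_left, wedge_succ_left q, vol_outer_inner]

theorem tauK_eq :
    vol n (wedge p 1 m * wedge q 0 (m + 2))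
    = pairing p q 1 m 2 m (q 0) (q 1) := by
  rw [wedge_succ_left, wedge_succ_left, vol_inner_inner_right]

theorem tauL_eq :
    vol n (wedge p 1 (m + 2) * wedge q 2 m)
    = pairing p q 1 m 2 m (p (1 + m)) (p (1 + m + 1)) := by
  rw [wedge_succ, wedge_succ, vol_inner_inner_left, ← add_assoc]

theorem tauF_raise :
    vol n ((2 : ℂ) • raise p 1 (m + 1) * wedge q 1 (m + 1))
    = 2 * pairing p q 1 m 2 m (p (1 + m + 1)) (q 1) := by
  rw [raise, wedge_succ_left q, smul_mul_assoc, map_smul, vol_inner_inner, smul_eq_mul]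

theorem tauF_lower :
    vol n (wedge p 1 (m + 1) * (-1 / 2 : ℂ) • lower q 0 (m + 1))
    = -1 / 2 * pairing p q 1 m 2 m (p (1 + m)) (q 0) := by
  rw [lower, wedge_succ, mul_smul_comm, map_smul, vol_inner_inner, smul_eq_mul]

theorem tauF_raise_lower :
    vol n ((2 : ℂ) • raise p 1 (m + 1) * (-1 / 2 : ℂ) • lower q 0 (m + 1))
    = 2 * (-1 / 2 * pairing p q 1 m 2 m (p (1 + m + 1)) (q 0)) := by
  rw [raise, lower, smul_mul_assoc, mul_smul_comm, map_smul, map_smul, vol_inner_inner,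
    smul_eq_mul, smul_eq_mul]

theorem tauG_raise :
    vol n ((2 : ℂ) • raise p 0 (m + 2) * wedge q 2 m)
    = 2 * ((-1) ^ m * pairing p q 1 m 2 m (p 0) (p (1 + m + 1))) := by
  rw [raise, wedge_succ_left, smul_mul_assoc, map_smul, mul_assoc (ι ℂ _), vol_outer_inner_left,
    smul_eq_mul]
  ring_nf

theorem tauH_lower :
    vol n (wedge p 0 (m + 1) * (-1 / 2 : ℂ) • lower q 0 (m + 1))
    = -1 / 2 * ((-1) ^ m * pairing p q 1 m 2 m (p 0) (q 0)) := by
  rw [lower, wedge_succ_left, mul_smul_comm, map_smul, vol_outer_inner, smul_eq_mul]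

end Tau

theorem bilinearSystem_wedge {n : ℕ} (m : ℕ) {p q : ℝ → ℕ → Vec n}
    {a : Matrix (Fin n) (Fin n) ℂ}
    (hp : ∀ x k, HasDerivAt (fun y => p y k) ((2 : ℂ) • p x (k + 1)) x)
    (hq : ∀ t k, HasDerivAt (fun y => q y (k + 1)) ((-1 / 2 : ℂ) • q t k) t)
    (hpa : ∀ x k, a.mulVec (p x k) = p x (k + 1))
    (hqa : ∀ t k, a.mulVec (q t k) = -q t (k + 1)) :
    BilinearSystem (1 / 2)
      (fun x t => vol n (wedge (p x) 1 (m + 1) * wedge (q t) 1 (m + 1)))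
      (fun x t => vol n (wedge (p x) 0 (m + 2) * wedge (q t) 2 m))
      (fun x t => vol n (wedge (p x) 0 (m + 1) * wedge (q t) 1 (m + 1)))
      (fun x t => vol n (wedge (p x) 1 m * wedge (q t) 0 (m + 2))) := by
  have hU := fun s k x => hasWeakDerivAt_raise (hp x) s k
  have hV1 (t : ℝ) : HasWeakDerivAt (fun y => wedge (q y) 1 (m + 1))
      ((-1 / 2 : ℂ) • lower (q t) 0 (m + 1)) t := hasWeakDerivAt_lower (hq t) 0 (m + 1)
  have hV2 (t : ℝ) : HasWeakDerivAt (fun y => wedge (q y) 2 m) ((-1 / 2 : ℂ) • lower (q t) 1 m) t :=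
    hasWeakDerivAt_lower (hq t) 1 m
  have jf := HasPartials.vol_mul (hU 1 (m + 1)) hV1
  have jg := HasPartials.vol_mul (hU 0 (m + 2)) hV2
  have jh := HasPartials.vol_mul (hU 0 (m + 1)) hV1
  have jl := HasPartials.vol_mul (hU 1 (m + 2)) hV2
  have jk (x t : ℝ) : HasDerivAt (fun y => vol n (wedge (p y) 1 m * wedge (q t) 0 (m + 2)))
      (vol n ((2 : ℂ) • raise (p x) 1 m * wedge (q t) 0 (m + 2))) x :=
    (hU 1 m x).vol_mul_const _
  refine ⟨_, _, _, _, _, _, _, _, _, _, jf, jg, jh, jk, fun x t => ?_,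
    fun x t => ?_, fun x t => ?_⟩
  · have h := pairing_plucker (p x) (q t) 1 m 2 m (p x (1 + m)) (q t 0) (p x 0) (q t 1)
    rw [pairing_swap (p x) (q t) 1 m 2 m (p x (1 + m)) (p x 0),
      pairing_swap (p x) (q t) 1 m 2 m (q t 0) (p x 0)] at h
    simp only [tauF_eq, tauG_eq, tauH_eq, tauK_eq, tauF_lower, tauH_lower]
    linear_combination (-1 / 2 * (-1) ^ m) * h
  · have h := pairing_plucker (p x) (q t) 1 m 2 m (p x (1 + m + 1)) (q t 0) (p x 0) (q t 1)
    rw [pairing_swap (p x) (q t) 1 m 2 m (p x (1 + m + 1)) (p x 0),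
      pairing_swap (p x) (q t) 1 m 2 m (q t 0) (p x 0)] at h
    simp only [tauH_eq, tauK_eq, tauF_raise, tauF_raise_lower, tauG_raise, tauH_lower]
    linear_combination (-(-1) ^ m) * h
  · refine hirota_eq_of_exchange jf jg jh jl (fun s => ?_) ?_ ?_
    · have h := pairing_plucker (p x) (q s) 1 m 2 m (p x 0) (p x (1 + m)) (p x (1 + m + 1)) (q s 1)
      simp only [tauF_eq, tauG_eq, tauH_eq, tauL_eq, tauF_raise, tauG_raise]
      linear_combination (2 * (-1) ^ m) * h
    · have h := pairing_plucker (p x) (q t) 1 m 2 m (p x 0) (p x (1 + m)) (p x (1 + m + 1)) (q t 0)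
      simp only [tauG_eq, tauL_eq, tauF_lower, tauF_raise_lower, tauG_raise, tauH_lower]
      linear_combination (-(-1) ^ m) * h
    · have h := lower_bilinear (hpa x) (hqa t) m
      simp only [mul_smul_comm, map_smul, smul_eq_mul]
      linear_combination -h

/-- The second equation acquires α times the first; the other two are only multiplied by the squared
gauge factor. -/
theorem BilinearSystem.gauge {c : ℂ} {f g h k : ℝ → ℝ → ℂ} (H : BilinearSystem c f g h k)
    {d e : ℝ → ℂ} {α β : ℂ} (hd : ∀ x, HasDerivAt d (α * d x) x)
    (he : ∀ t, HasDerivAt e (β * e t) t) :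
    BilinearSystem c (fun x t => d x * e t * f x t) (fun x t => d x * e t * g x t)
      (fun x t => d x * e t * h x t) (fun x t => d x * e t * k x t) := by
  obtain ⟨fx, ft, fxt, gx, gt, gxt, hx, ht, hxt, kx, jf, jg, jh, jk, h1, h2, h3⟩ := H
  refine ⟨_, _, _, _, _, _, _, _, _, _, jf.gauge hd he, jg.gauge hd he, jh.gauge hd he,
    fun x t => ((hd x).mul_const (e t)).mul (jk x t), ?_, ?_, ?_⟩
  · intro x t
    linear_combination (d x * e t) ^ 2 * h1 x t
  · intro x t
    linear_combination (d x * e t) ^ 2 * (h2 x t + α * h1 x t)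
  · intro x t
    linear_combination (d x * e t) ^ 2 * h3 x t

theorem BilinearSystem.const_mul {c c' γ γ' : ℂ} {f g h k : ℝ → ℝ → ℂ}
    (H : BilinearSystem c f g h k) (hc : c * γ = c' * γ') :
    BilinearSystem c' f g (fun x t => γ * h x t) (fun x t => γ' * k x t) := by
  obtain ⟨fx, ft, fxt, gx, gt, gxt, hx, ht, hxt, kx, jf, jg, jh, jk, h1, h2, h3⟩ := H
  refine ⟨_, _, _, _, _, _, _, _, _, _, jf, jg, jh.const_mul γ,
    fun x t => (jk x t).const_mul γ', ?_, ?_, h3⟩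
  · intro x t
    linear_combination γ * h1 x t + g x t * k x t * hc
  · intro x t
    linear_combination γ * h2 x t + gx x t * k x t * hc

theorem BilinearSystem.hirota {c : ℂ} {f g h k : ℝ → ℝ → ℂ} (H : BilinearSystem c f g h k)
    (x t : ℝ) :
    hirota 1 1 g f x t + g x t * f x t = 0 ∧
    hirota 1 1 f h x t - c * hirota 1 0 g k x t = 0 ∧
    hirota 0 1 f h x t - c * (g x t * k x t) = 0 := by
  obtain ⟨fx, ft, fxt, gx, gt, gxt, hx, ht, hxt, kx, jf, jg, jh, jk, h1, h2, h3⟩ := H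
  rw [hirota_one_one jg jf, hirota_one_one jf jh, hirota_one_zero jg.x jk, hirota_zero_one jf jh]
  refine ⟨h3 x t, ?_, by linear_combination h1 x t⟩
  -- Twice the second equation minus the x-derivative of the first gives D_x D_t f·h = c D_x g·k.
  have d1 := ((jf.tx x t).mul (jh.x x t)).sub ((jf.x x t).mul (jh.tx x t))
  have d2 := ((jg.x x t).mul (jk x t)).const_mul c
  have d := d1.unique (d2.congr_of_eventuallyEq (Filter.Eventually.of_forall fun y => h1 y t))
  linear_combination 2 * h2 x t - d

theorem BilinearSystem.quotient {c : ℂ} {f g h k : ℝ → ℝ → ℂ} (H : BilinearSystem c f g h k)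
    {x t : ℝ} (hf : f x t ≠ 0) (hh : h x t ≠ 0) :
    pdt (pdx fun x t => g x t / f x t) x t + g x t / f x t
      + 2 * c * (g x t / f x t) * (k x t / h x t) * pdx (fun x t => g x t / f x t) x t = 0 := by
  obtain ⟨fx, ft, fxt, gx, gt, gxt, hx, ht, hxt, kx, jf, jg, jh, jk, h1, h2, h3⟩ := H
  have ux : ∀ s, f x s ≠ 0 → pdx (fun x t => g x t / f x t) x s
      = (gx x s * f x s - g x s * fx x s) / f x s ^ 2 := fun s hs =>
    ((jg.x x s).div (jf.x x s) hs).deriv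
  have ev : ∀ᶠ s in nhds t, f x s ≠ 0 := (jf.t x t).continuousAt.eventually_ne hf
  have uxt : pdt (pdx fun x t => g x t / f x t) x t = _ :=
    (((((jg.xt x t).mul (jf.t x t)).sub ((jg.t x t).mul (jf.xt x t))).div
      ((jf.t x t).pow 2) (pow_ne_zero 2 hf)).congr_of_eventuallyEq
        (ev.mono fun s hs => ux s hs)).deriv
  rw [uxt, ux t hf]
  simp only [Pi.mul_apply, Pi.sub_apply, Pi.pow_apply]
  -- Eliminating h_t between the first two equations leaves (log f)_{xt} in terms of k/h and u_x.
  have key : (f x t * fxt x t - fx x t * ft x t) * h x t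
      = c * k x t * (f x t * gx x t - g x t * fx x t) := by
    linear_combination f x t * h2 x t - fx x t * h1 x t
  field_simp
  linear_combination h x t * f x t ^ 2 * h3 x t - 2 * f x t * g x t * key

/-! ### Matrix exponentials: derivatives and smoothness -/

section Exp

variable {n : ℕ} (M : Matrix (Fin n) (Fin n) ℂ)

theorem hasDerivAt_mulVec {v : ℝ → Vec n} {v' : Vec n} {x : ℝ} (hv : HasDerivAt v v' x) :
    HasDerivAt (fun y => M.mulVec (v y)) (M.mulVec v') x := by
  rw [hasDerivAt_pi] at hv ⊢
  intro i
  simp only [Matrix.mulVec, dotProduct]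
  exact HasDerivAt.fun_sum fun j _ => (hv j).const_mul (M i j)

open scoped Matrix.Norms.Operator in
theorem hasDerivAt_exp_smul_mulVec (c : ℂ) (v : Vec n) (x : ℝ) :
    HasDerivAt (fun y : ℝ => (NormedSpace.exp ((c * (y : ℂ)) • M)).mulVec v)
      (c • M.mulVec ((NormedSpace.exp ((c * (x : ℂ)) • M)).mulVec v)) x := by
  have h := hasDerivAt_exp_smul_const' (𝕂 := ℂ) (c • M) (x : ℂ)
  have h1 := (LinearMap.toContinuousLinearMap
    ((Matrix.mulVecBilin ℂ ℂ).flip v : Matrix (Fin n) (Fin n) ℂ →ₗ[ℂ] Vec n)).hasFDerivAt.comp_hasDerivAt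
      (x : ℂ) h
  have h2 := hasDerivAt_pi.2 fun i => (hasDerivAt_pi.1 h1 i).comp_ofReal
  convert! h2 using 1
  · ext y
    simp [smul_smul, mul_comm]
    rfl
  · rw [smul_smul, mul_comm (x : ℂ), Matrix.mulVec_mulVec, ← Matrix.smul_mulVec, ← smul_mul_assoc]
    rfl

open scoped Matrix.Norms.Operator in
theorem contDiff_exp_matrix :
    ContDiff ℝ ∞ (NormedSpace.exp : Matrix (Fin n) (Fin n) ℂ → Matrix (Fin n) (Fin n) ℂ) := by
  rw [contDiff_iff_contDiffAt]
  intro X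
  exact (NormedSpace.exp_analytic (𝕂 := ℝ) X).contDiffAt

open scoped Matrix.Norms.Operator in
theorem contDiff_exp_add_smul_apply (M' : Matrix (Fin n) (Fin n) ℂ) (c : ℂ) (i j : Fin n) :
    ContDiff ℝ ∞ (fun z : ℝ × ℝ =>
      NormedSpace.exp ((c * (z.1 : ℂ)) • M + (c * (z.2 : ℂ)) • M') i j) := by
  have h1 : ContDiff ℝ ∞ (fun z : ℝ × ℝ => (c * (z.1 : ℂ)) • M + (c * (z.2 : ℂ)) • M') := by
    have l1 : ContDiff ℝ ∞ (fun z : ℝ × ℝ => (z.1 : ℂ)) := Complex.ofRealCLM.contDiff.comp contDiff_fst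
    have l2 : ContDiff ℝ ∞ (fun z : ℝ × ℝ => (z.2 : ℂ)) := Complex.ofRealCLM.contDiff.comp contDiff_snd
    exact ((contDiff_const.mul l1).smul contDiff_const).add
      ((contDiff_const.mul l2).smul contDiff_const)
  have h2 := contDiff_exp_matrix.comp h1
  exact (LinearMap.toContinuousLinearMap
    (Matrix.entryLinearMap ℝ ℂ i j : Matrix (Fin n) (Fin n) ℂ →ₗ[ℝ] ℂ)).contDiff.comp h2

theorem contDiff_det {E : Type*} [NormedAddCommGroup E] [NormedSpace ℝ E]
    {X : E → Matrix (Fin n) (Fin n) ℂ} (hX : ∀ i j, ContDiff ℝ ∞ fun z => X z i j) :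
    ContDiff ℝ ∞ fun z => (X z).det := by
  simp only [Matrix.det_apply']
  exact ContDiff.sum fun σ _ => contDiff_const.mul (contDiff_prod fun i _ => hX _ _)

/-- The determinant is multiplicative along a one-parameter group, so differentiability at 0 gives
D' = D'(0) D; the value of the rate is irrelevant. -/
theorem exists_hasDerivAt_det_exp (c : ℂ) : ∃ α : ℂ, ∀ x : ℝ,
    HasDerivAt (fun y : ℝ => (NormedSpace.exp ((c * (y : ℂ)) • M)).det)
      (α * (NormedSpace.exp ((c * (x : ℂ)) • M)).det) x := by
  set D : ℝ → ℂ := fun y => (NormedSpace.exp ((c * (y : ℂ)) • M)).det with hD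
  have hmul : ∀ x y, D (x + y) = D x * D y := by
    intro x y
    simp only [hD, Complex.ofReal_add, mul_add, add_smul]
    rw [Matrix.exp_add_of_commute _ _ (((Commute.refl M).smul_left _).smul_right _),
      Matrix.det_mul]
  have hdiff : DifferentiableAt ℝ D 0 := by
    have h : ContDiff ℝ ∞ fun z : ℝ × ℝ =>
        (NormedSpace.exp ((c * (z.1 : ℂ)) • M + (c * (z.2 : ℂ)) • (0 : Matrix (Fin n) (Fin n) ℂ))).det :=
      contDiff_det fun i j => contDiff_exp_add_smul_apply M 0 c i j
    have h' := h.comp (contDiff_prodMk_left (0 : ℝ))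
    simp only [smul_zero, add_zero, Function.comp_def] at h'
    exact h'.differentiable (by simp) 0
  refine ⟨deriv D 0, fun x => ?_⟩
  have h0 : HasDerivAt D (deriv D 0) (x - x) := by simpa using hdiff.hasDerivAt
  have h1 := (h0.comp_sub_const x x).const_mul (D x)
  rw [mul_comm]
  convert! h1 using 2 with y
  rw [← hmul]
  simp

end Exp

/-! ### Double Wronskians as wedge products -/

/-- Double Wronskians as determinants of wedge products of columns. -/
theorem doubleWronskian_eq_vol {n : ℕ} (φ ψ : ℝ → ℝ → Fin n → ℂ) (a b p q : ℕ) (h : a + b = n)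
    (x t : ℝ) :
    doubleWronskian φ ψ a p q x t
      = vol n (wedge (fun k i => iteratedDeriv k (fun y => φ y t i) x) p a
        * wedge (fun k i => iteratedDeriv k (fun y => ψ y t i) x) q b) := by
  subst h
  rw [doubleWronskian, wedge, wedge, ιMulti_mul_ιMulti, vol_ιMulti, ← Matrix.det_transpose]
  congr 1
  ext i j
  refine Fin.addCases (fun i => ?_) (fun i => ?_) i <;> simp

theorem iteratedDeriv_of_hasDerivAt {n : ℕ} {M : Matrix (Fin n) (Fin n) ℂ} {v : ℝ → Vec n}
    (h : ∀ x, HasDerivAt v (M.mulVec (v x)) x) (k : ℕ) :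
    ∀ (x : ℝ) (i : Fin n), iteratedDeriv k (fun y => v y i) x = (M ^ k).mulVec (v x) i := by
  induction k with
  | zero => simp
  | succ k ih =>
    intro x i
    rw [iteratedDeriv_succ, show iteratedDeriv k (fun y => v y i) = _ from funext fun y => ih y i,
      (hasDerivAt_pi.1 (hasDerivAt_mulVec (M ^ k) (h x)) i).deriv, Matrix.mulVec_mulVec, pow_succ]

/-- The sign `∏_{i < k} (-1) ^ i` squares to one. -/
theorem prod_neg_one_pow_sq (k : ℕ) : (∏ i ∈ Finset.range k, (-1 : ℂ) ^ i) ^ 2 = 1 := by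
  rw [← Finset.prod_pow]
  refine Finset.prod_eq_one fun i _ => ?_
  rw [← pow_mul, mul_comm, pow_mul]
  simp

/-! ### Signs and constants under reversal -/

section Reversal

variable {n : ℕ} {p q : ℕ → Vec n} {a : Matrix (Fin n) (Fin n) ℂ}

theorem wedge_alternating_smul (c : ℂ) (v : ℕ → Vec n) (s k : ℕ) :
    wedge (fun i => (c * (-1) ^ i) • v i) s k
      = (c ^ k * ((-1) ^ s) ^ k * ∏ i ∈ Finset.range k, (-1 : ℂ) ^ i) • wedge v s k := by
  rw [wedge_smul (fun i => c * (-1) ^ i)]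
  simp only [pow_add, Finset.prod_mul_distrib, Finset.prod_const, Finset.card_range, mul_assoc]

/-- The sign collects the alternating scalars (r l, s k and the two products), the exchange of the
two blocks (l k) and the index shift, where each q changes sign (l). -/
theorem vol_reversal (hp : ∀ k, a.mulVec (p k) = p (k + 1))
    (hq : ∀ k, a.mulVec (q k) = -q (k + 1)) (c d : ℂ) (r l s k : ℕ) :
    vol n (wedge (fun i => (c * (-1) ^ i) • q (i + 1)) r l
        * wedge (fun i => (d * (-1) ^ i) • p (i + 1)) s k)
      = c ^ l * d ^ k * ((-1) ^ (r * l + s * k + l * k + l)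
        * (∏ i ∈ Finset.range l, (-1 : ℂ) ^ i) * ∏ i ∈ Finset.range k, (-1 : ℂ) ^ i)
        * (a.det * vol n (wedge p s k * wedge q r l)) := by
  rw [wedge_alternating_smul c (fun i => q (i + 1)), wedge_alternating_smul d (fun i => p (i + 1)),
    wedge_shift, wedge_shift, smul_mul_assoc, mul_smul_comm, wedge_mul_wedge_comm, map_smul,
    map_smul, map_smul, vol_shift hp hq]
  simp only [smul_eq_mul, pow_add, pow_mul]
  ring

theorem vol_reversal_balanced (hp : ∀ k, a.mulVec (p k) = p (k + 1))
    (hq : ∀ k, a.mulVec (q k) = -q (k + 1)) (c d : ℂ) (m : ℕ) :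
    vol n (wedge (fun i => (c * (-1) ^ i) • q (i + 1)) 1 (m + 1)
        * wedge (fun i => (d * (-1) ^ i) • p (i + 1)) 0 (m + 1))
      = (-(c * d)) ^ (m + 1) * (a.det * vol n (wedge p 0 (m + 1) * wedge q 1 (m + 1))) := by
  rw [vol_reversal hp hq]
  have h := prod_neg_one_pow_sq (m + 1)
  have e : (-1 : ℂ) ^ (1 * (m + 1) + 0 * (m + 1) + (m + 1) * (m + 1) + (m + 1)) = (-1) ^ (m + 1) := by
    rw [show 1 * (m + 1) + 0 * (m + 1) + (m + 1) * (m + 1) + (m + 1)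
      = (m + 1) * (m + 2) + (m + 1) by ring, pow_add, (Nat.even_mul_succ_self (m + 1)).neg_one_pow,
      one_mul]
  rw [e, neg_pow (c * d), mul_pow]
  linear_combination (c ^ (m + 1) * d ^ (m + 1) * (-1) ^ (m + 1)
    * (a.det * vol n (wedge p 0 (m + 1) * wedge q 1 (m + 1)))) * h

theorem vol_reversal_unbalanced (hp : ∀ k, a.mulVec (p k) = p (k + 1))
    (hq : ∀ k, a.mulVec (q k) = -q (k + 1)) (c d : ℂ) (m : ℕ) :
    vol n (wedge (fun i => (c * (-1) ^ i) • q (i + 1)) 0 (m + 2)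
        * wedge (fun i => (d * (-1) ^ i) • p (i + 1)) 1 m)
      = -(c ^ 2 * (-(c * d)) ^ m) * (a.det * vol n (wedge p 1 m * wedge q 0 (m + 2))) := by
  rw [vol_reversal hp hq, Finset.prod_range_succ, Finset.prod_range_succ]
  have h := prod_neg_one_pow_sq m
  have e : (-1 : ℂ) ^ (0 * (m + 2) + 1 * m + (m + 2) * m + (m + 2)) * (-1) ^ m * (-1) ^ (m + 1)
      = -(-1) ^ m := by
    rw [← pow_add, ← pow_add, show 0 * (m + 2) + 1 * m + (m + 2) * m + (m + 2) + m + (m + 1)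
      = m * (m + 1) + 2 * (2 * m + 1) + (m + 1) by ring, pow_add, pow_add,
      (Nat.even_mul_succ_self m).neg_one_pow, pow_mul, pow_succ]
    simp [pow_succ]
  rw [neg_pow (c * d), mul_pow]
  linear_combination (-c ^ (m + 2) * d ^ m * (-1) ^ m
    * (a.det * vol n (wedge p 1 m * wedge q 0 (m + 2)))) * h
    + (c ^ (m + 2) * d ^ m * (∏ i ∈ Finset.range m, (-1 : ℂ) ^ i) ^ 2
    * (a.det * vol n (wedge p 1 m * wedge q 0 (m + 2)))) * e

end Reversal

/-! ### The two-parameter flow and the gauge -/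

section Flow

variable {n : ℕ} (A T : Matrix (Fin n) (Fin n) ℂ) (C : Vec n)

/-- The generator `(i/2) A²` of the flow in `x`. -/
noncomputable def genX : Matrix (Fin n) (Fin n) ℂ := (Complex.I / 2) • A ^ 2

/-- The generator `(i/2) A⁻²` of the flow in `t`. -/
noncomputable def genT : Matrix (Fin n) (Fin n) ℂ := (Complex.I / 2) • A⁻¹ ^ 2

/-- The two-parameter flow `exp(s (i/2) A² + r (i/2) A⁻²)`. -/
noncomputable def flow (s r : ℂ) : Matrix (Fin n) (Fin n) ℂ :=
  NormedSpace.exp (s • genX A + r • genT A)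

variable {A T}

theorem inv_mul_self_of_isUnit (hA : IsUnit A) : A⁻¹ * A = 1 :=
  Matrix.nonsing_inv_mul A ((Matrix.isUnit_iff_isUnit_det A).1 hA)

theorem self_mul_inv_of_isUnit (hA : IsUnit A) : A * A⁻¹ = 1 :=
  Matrix.mul_nonsing_inv A ((Matrix.isUnit_iff_isUnit_det A).1 hA)

theorem commute_inv {B : Matrix (Fin n) (Fin n) ℂ} (hA : IsUnit A) (h : Commute B A) :
    Commute B A⁻¹ := by
  have h1 := self_mul_inv_of_isUnit hA
  have h2 := inv_mul_self_of_isUnit hA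
  calc B * A⁻¹ = A⁻¹ * A * B * A⁻¹ := by rw [h2, one_mul]
    _ = A⁻¹ * (B * A) * A⁻¹ := by rw [h.eq]; simp only [mul_assoc]
    _ = A⁻¹ * B := by rw [mul_assoc, mul_assoc, h1, mul_one]

theorem commute_genX {B : Matrix (Fin n) (Fin n) ℂ} (h : Commute B A) : Commute B (genX A) :=
  (h.pow_right 2).smul_right _

theorem commute_genT {B : Matrix (Fin n) (Fin n) ℂ} (hA : IsUnit A) (h : Commute B A) :
    Commute B (genT A) :=
  ((commute_inv hA h).pow_right 2).smul_right _

theorem commute_flow {B : Matrix (Fin n) (Fin n) ℂ} (hA : IsUnit A) (h : Commute B A) (s r : ℂ) :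
    Commute B (flow A s r) := by
  have h1 : Commute B (s • genX A + r • genT A) :=
    ((commute_genX h).smul_right s).add_right ((commute_genT hA h).smul_right r)
  open scoped Matrix.Norms.Operator in exact h1.exp_right

theorem commute_genX_genT (hA : IsUnit A) : Commute (genX A) (genT A) :=
  commute_genT hA ((commute_genX (Commute.refl A)).symm)

theorem flow_mul_flow (hA : IsUnit A) (s r s' r' : ℂ) :
    flow A s r * flow A s' r' = flow A (s + s') (r + r') := by
  have h := commute_genX_genT hA
  have hc : Commute (s • genX A + r • genT A) (s' • genX A + r' • genT A) :=
    ((((Commute.refl _).smul_left s).smul_right s').add_right ((h.smul_left s).smul_right r')).add_left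
      (((h.symm.smul_left r).smul_right s').add_right (((Commute.refl _).smul_left r).smul_right r'))
  rw [flow, flow, ← Matrix.exp_add_of_commute _ _ hc, flow]
  congr 1
  module

theorem phiVec_eq_flow (x t : ℝ) : phiVec A C x t = (flow A x t).mulVec C := by
  rw [phiVec, flow, genX, genT, smul_smul, smul_smul, mul_comm (x : ℂ), mul_comm (t : ℂ)]

variable (A T) in
/-- The columns `∂_x^k φ` in the gauge in which they depend on `x` only. -/
noncomputable def pCol (x : ℝ) (k : ℕ) : Vec n :=
  (genX A ^ k).mulVec ((NormedSpace.exp ((2 * (x : ℂ)) • genX A)).mulVec C)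

variable (A T) in
/-- The columns `∂_x^{k-1} ψ` in the gauge in which they depend on `t` only. -/
noncomputable def qCol (t : ℝ) (k : ℕ) : Vec n :=
  ((-genX A) ^ k).mulVec (((4 : ℂ) • genT A).mulVec
    ((NormedSpace.exp ((-2 * (t : ℂ)) • genT A)).mulVec ((A * T).mulVec C)))

theorem hasDerivAt_pCol (x : ℝ) (k : ℕ) :
    HasDerivAt (fun y => pCol A C y k) ((2 : ℂ) • pCol A C x (k + 1)) x := by
  have h := hasDerivAt_mulVec (genX A ^ k) (hasDerivAt_exp_smul_mulVec (genX A) 2 C x)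
  rw [Matrix.mulVec_smul, Matrix.mulVec_mulVec, ← pow_succ] at h
  exact h

/-- Makes `qCol` at index 0 a formal x-antiderivative of ψ: index k + 1 corresponds to ∂_x^k ψ, and
differentiation in t lowers the index. -/
theorem genX_mul_genT (hA : IsUnit A) : -genX A * ((4 : ℂ) • genT A) = 1 := by
  have h : A ^ 2 * A⁻¹ ^ 2 = 1 := by
    rw [← (commute_inv hA (Commute.refl A)).mul_pow, self_mul_inv_of_isUnit hA, one_pow]
  have hI : -(Complex.I / 2 * (4 * (Complex.I / 2))) = 1 := by
    linear_combination -Complex.I_mul_I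
  rw [genX, genT, smul_smul, neg_mul, smul_mul_smul_comm, h, ← neg_smul, hI, one_smul]

theorem qCol_succ (hA : IsUnit A) (t : ℝ) (k : ℕ) :
    qCol A T C t (k + 1) = ((-genX A) ^ k).mulVec
      ((NormedSpace.exp ((-2 * (t : ℂ)) • genT A)).mulVec ((A * T).mulVec C)) := by
  rw [qCol, Matrix.mulVec_mulVec, pow_succ, mul_assoc, genX_mul_genT hA, mul_one]

theorem hasDerivAt_qCol (hA : IsUnit A) (t : ℝ) (k : ℕ) :
    HasDerivAt (fun y => qCol A T C y (k + 1)) ((-1 / 2 : ℂ) • qCol A T C t k) t := by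
  have h := hasDerivAt_mulVec ((-genX A) ^ k)
    (hasDerivAt_exp_smul_mulVec (genT A) (-2) ((A * T).mulVec C) t)
  simp only [qCol_succ C hA]
  convert! h using 1
  rw [qCol, Matrix.smul_mulVec, ← Matrix.mulVec_smul, smul_smul]
  norm_num

theorem mulVec_pCol (x : ℝ) (k : ℕ) : (genX A).mulVec (pCol A C x k) = pCol A C x (k + 1) := by
  rw [pCol, Matrix.mulVec_mulVec, ← pow_succ', pCol]

theorem mulVec_qCol (t : ℝ) (k : ℕ) : (genX A).mulVec (qCol A T C t k) = -qCol A T C t (k + 1) := by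
  rw [qCol, Matrix.mulVec_mulVec, qCol, pow_succ', neg_mul (genX A), Matrix.neg_mulVec, neg_neg]

/-- Rests on flow(x, t) = flow(-x, t) flow(2x, 0); for ψ the same prefactor leaves flow(0, -2t). -/
theorem genX_pow_mulVec_phiVec (hA : IsUnit A) (x t : ℝ) (k : ℕ) :
    (genX A ^ k).mulVec (phiVec A C x t) = (flow A (-x) t).mulVec (pCol A C x k) := by
  have h : Commute (genX A ^ k) (flow A (-x) t) :=
    commute_flow hA ((commute_genX (Commute.refl A)).symm.pow_left k) _ _
  have e : NormedSpace.exp ((2 * (x : ℂ)) • genX A) = flow A (2 * x) 0 := by simp [flow]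
  rw [pCol, e, Matrix.mulVec_mulVec, ← h.eq, ← Matrix.mulVec_mulVec, Matrix.mulVec_mulVec C,
    flow_mul_flow hA, phiVec_eq_flow]
  ring_nf

theorem genX_pow_mulVec_psiVec (hA : IsUnit A) (hAT : Commute A T) (x t : ℝ) (k : ℕ) :
    ((-genX A) ^ k).mulVec (psiVec A T C x t) = (flow A (-x) t).mulVec (qCol A T C t (k + 1)) := by
  have h : Commute ((-genX A) ^ k) (flow A (-x) t) :=
    commute_flow hA ((commute_genX (Commute.refl A)).symm.neg_left.pow_left k) _ _
  have h' : ∀ s r, Commute (A * T) (flow A s r) := fun s r =>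
    commute_flow hA ((Commute.refl A).mul_left hAT.symm) s r
  have e : NormedSpace.exp ((-2 * (t : ℂ)) • genT A) = flow A 0 (-2 * t) := by simp [flow]
  rw [qCol_succ C hA, e, Matrix.mulVec_mulVec, ← h.eq, ← Matrix.mulVec_mulVec,
    Matrix.mulVec_mulVec ((A * T).mulVec C), flow_mul_flow hA, psiVec, phiVec_eq_flow,
    Matrix.mulVec_mulVec C (A * T), (h' _ _).eq, ← Matrix.mulVec_mulVec C]
  push_cast
  ring_nf

end Flow

/-! ### Gauge form and reversal of the solution -/

section Solution

variable {n : ℕ} {A T : Matrix (Fin n) (Fin n) ℂ} (C : Vec n)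

theorem hasDerivAt_phiVec (hA : IsUnit A) (x t : ℝ) :
    HasDerivAt (fun y => phiVec A C y t) ((genX A).mulVec (phiVec A C x t)) x := by
  have e : ∀ y : ℝ, phiVec A C y t
      = (NormedSpace.exp ((1 * (y : ℂ)) • genX A)).mulVec ((flow A 0 t).mulVec C) := fun y => by
    have : NormedSpace.exp ((1 * (y : ℂ)) • genX A) = flow A y 0 := by simp [flow]
    rw [this, Matrix.mulVec_mulVec, flow_mul_flow hA, phiVec_eq_flow, add_zero, zero_add]
  simp only [e]
  simpa only [one_smul] using hasDerivAt_exp_smul_mulVec (genX A) 1 ((flow A 0 t).mulVec C) x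

theorem hasDerivAt_psiVec (hA : IsUnit A) (hAT : Commute A T) (x t : ℝ) :
    HasDerivAt (fun y => psiVec A T C y t) ((-genX A).mulVec (psiVec A T C x t)) x := by
  have h := hasDerivAt_mulVec (A * T)
    ((hasDerivAt_phiVec C hA (-x) (-t)).scomp x (hasDerivAt_neg x))
  have hc : Commute (A * T) (genX A) := commute_genX ((Commute.refl A).mul_left hAT.symm)
  convert! h using 1
  rw [psiVec, neg_one_smul, Matrix.mulVec_neg, Matrix.neg_mulVec, Matrix.mulVec_mulVec,
    Matrix.mulVec_mulVec, hc.eq]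

theorem doubleWronskian_eq_columns (hA : IsUnit A) (hAT : Commute A T) {a b : ℕ} (h : a + b = n)
    (p q : ℕ) (x t : ℝ) :
    doubleWronskian (phiVec A C) (psiVec A T C) a p q x t
      = vol n (wedge (fun k => (genX A ^ k).mulVec (phiVec A C x t)) p a
        * wedge (fun k => ((-genX A) ^ k).mulVec (psiVec A T C x t)) q b) := by
  rw [doubleWronskian_eq_vol _ _ a b p q h]
  congr 3
  · funext k i
    exact iteratedDeriv_of_hasDerivAt (fun y => hasDerivAt_phiVec C hA y t) k x i
  · funext k i
    exact iteratedDeriv_of_hasDerivAt (fun y => hasDerivAt_psiVec C hA hAT y t) k x i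

theorem doubleWronskian_eq_gauge (hA : IsUnit A) (hAT : Commute A T) {a b : ℕ} (h : a + b = n)
    (p q : ℕ) (x t : ℝ) :
    doubleWronskian (phiVec A C) (psiVec A T C) a p q x t
      = (flow A (-x) t).det * vol n (wedge (pCol A C x) p a * wedge (qCol A T C t) (q + 1) b) := by
  rw [doubleWronskian_eq_columns C hA hAT h, ← vol_map, map_mul (ExteriorAlgebra.map _), map_wedge,
    map_wedge, ← wedge_shift]
  simp only [genX_pow_mulVec_phiVec C hA, genX_pow_mulVec_psiVec C hA hAT]

theorem phiVec_neg {δ : ℂ} (hδ : δ ^ 2 = 1) (hA : IsUnit A) (hT : T ^ 2 = δ • 1) (x t : ℝ) :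
    phiVec A C (-x) (-t) = (T * A⁻¹).mulVec (δ • psiVec A T C x t) := by
  have h : T * A⁻¹ * (A * T) = δ • 1 := by
    rw [mul_assoc, ← mul_assoc A⁻¹, inv_mul_self_of_isUnit hA, one_mul, ← pow_two, hT]
  rw [psiVec, Matrix.mulVec_smul, Matrix.mulVec_mulVec, h, Matrix.smul_mulVec, smul_smul,
    ← pow_two, hδ, Matrix.one_mulVec, one_smul]

theorem psiVec_neg (hA : IsUnit A) (hAT : Commute A T) (x t : ℝ) :
    psiVec A T C (-x) (-t)
      = (T * A⁻¹).mulVec ((-2 * Complex.I) • (genX A).mulVec (phiVec A C x t)) := by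
  have h : (-2 * Complex.I) • genX A = A ^ 2 := by
    have hI : -2 * Complex.I * (Complex.I / 2) = 1 := by linear_combination -Complex.I_mul_I
    rw [genX, smul_smul, hI, one_smul]
  rw [← Matrix.smul_mulVec, h, Matrix.mulVec_mulVec, mul_assoc, pow_two, ← mul_assoc A⁻¹,
    inv_mul_self_of_isUnit hA, one_mul, psiVec, neg_neg, neg_neg, hAT.eq]

/-- Since T A⁻¹ commutes with X, it leaves every column as a common factor. The roles of φ and ψ are
exchanged, and the signs (-1)^k record that X acts on the two with opposite signs. -/
theorem doubleWronskian_reversed {δ : ℂ} (hδ : δ ^ 2 = 1) (hA : IsUnit A) (hAT : Commute A T)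
    (hT : T ^ 2 = δ • 1) {a b : ℕ} (h : a + b = n) (p q : ℕ) (x t : ℝ) :
    doubleWronskian (phiVec A C) (psiVec A T C) a p q (-x) (-t)
      = (T * A⁻¹).det * ((flow A (-x) t).det
        * vol n (wedge (fun k => (δ * (-1) ^ k) • qCol A T C t (k + 1)) p a
          * wedge (fun k => ((-2 * Complex.I) * (-1) ^ k) • pCol A C x (k + 1)) q b)) := by
  have hZ : Commute (T * A⁻¹) (genX A) :=
    commute_genX (hAT.symm.mul_left (commute_inv hA (Commute.refl A)).symm)
  have hn : ∀ k, (-genX A) ^ k = (-1 : ℂ) ^ k • genX A ^ k := fun k => by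
    rw [← neg_one_smul ℂ (genX A), smul_pow]
  have c1 : ∀ k, (genX A ^ k).mulVec (phiVec A C (-x) (-t)) = (T * A⁻¹).mulVec
      ((flow A (-x) t).mulVec ((δ * (-1) ^ k) • qCol A T C t (k + 1))) := fun k => by
    rw [phiVec_neg C hδ hA hT, Matrix.mulVec_mulVec, ← (hZ.pow_right k).eq, ← Matrix.mulVec_mulVec,
      Matrix.mulVec_smul, Matrix.mulVec_smul (flow A (-x) t), ← genX_pow_mulVec_psiVec C hA hAT,
      hn, Matrix.smul_mulVec, ← smul_smul, neg_one_pow_smul_smul]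
  have c2 : ∀ k, ((-genX A) ^ k).mulVec (psiVec A T C (-x) (-t)) = (T * A⁻¹).mulVec
      ((flow A (-x) t).mulVec ((-2 * Complex.I * (-1) ^ k) • pCol A C x (k + 1))) := fun k => by
    rw [psiVec_neg C hA hAT, hn, Matrix.smul_mulVec, Matrix.mulVec_mulVec,
      ← (hZ.pow_right k).eq, ← Matrix.mulVec_mulVec, ← Matrix.mulVec_smul,
      Matrix.mulVec_smul (genX A ^ k), Matrix.mulVec_mulVec, ← pow_succ,
      genX_pow_mulVec_phiVec C hA, Matrix.mulVec_smul (flow A (-x) t), smul_smul,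
      mul_comm ((-1 : ℂ) ^ k)]
  rw [doubleWronskian_eq_columns C hA hAT h, ← vol_map, ← vol_map, map_mul (ExteriorAlgebra.map _),
    map_mul (ExteriorAlgebra.map _), map_wedge, map_wedge, map_wedge, map_wedge]
  simp only [c1, c2]

end Solution

/-! ### Joint smoothness, assembly and block matrices -/

theorem contDiff_mulVec_apply {n : ℕ} (M : Matrix (Fin n) (Fin n) ℂ) {v : ℝ × ℝ → Vec n}
    (hv : ∀ i, ContDiff ℝ ∞ fun z => v z i) (i : Fin n) :
    ContDiff ℝ ∞ fun z => M.mulVec (v z) i := by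
  simp only [Matrix.mulVec, dotProduct]
  exact ContDiff.sum fun j _ => contDiff_const.mul (hv j)

theorem contDiff_phiVec_apply {n : ℕ} (A : Matrix (Fin n) (Fin n) ℂ) (C : Vec n) (i : Fin n) :
    ContDiff ℝ ∞ fun z : ℝ × ℝ => phiVec A C z.1 z.2 i := by
  simp only [phiVec, Matrix.mulVec, dotProduct]
  exact ContDiff.sum fun j _ =>
    (contDiff_exp_add_smul_apply (A ^ 2) (A⁻¹ ^ 2) (Complex.I / 2) i j).mul contDiff_const

theorem contDiff_psiVec_apply {n : ℕ} (A T : Matrix (Fin n) (Fin n) ℂ) (C : Vec n) (i : Fin n) :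
    ContDiff ℝ ∞ fun z : ℝ × ℝ => psiVec A T C z.1 z.2 i := by
  simp only [psiVec]
  refine contDiff_mulVec_apply (A * T) (fun j => ?_) i
  have h := (contDiff_phiVec_apply A C j).comp (contDiff_neg (𝕜 := ℝ) (F := ℝ × ℝ) (n := ∞))
  simp only [Function.comp_def, Prod.fst_neg, Prod.snd_neg] at h
  exact h

theorem contDiff_doubleWronskian {n : ℕ} {A T : Matrix (Fin n) (Fin n) ℂ} (C : Vec n)
    (hA : IsUnit A) (hAT : Commute A T) (a p q : ℕ) :
    ContDiff ℝ ∞ fun z : ℝ × ℝ =>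
      doubleWronskian (phiVec A C) (psiVec A T C) a p q z.1 z.2 := by
  have h1 : ∀ k x t i, iteratedDeriv k (fun y => phiVec A C y t i) x
      = (genX A ^ k).mulVec (phiVec A C x t) i := fun k x t =>
    iteratedDeriv_of_hasDerivAt (fun y => hasDerivAt_phiVec C hA y t) k x
  have h2 : ∀ k x t i, iteratedDeriv k (fun y => psiVec A T C y t i) x
      = ((-genX A) ^ k).mulVec (psiVec A T C x t) i := fun k x t =>
    iteratedDeriv_of_hasDerivAt (fun y => hasDerivAt_psiVec C hA hAT y t) k x
  simp only [doubleWronskian, h1, h2]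
  refine contDiff_det fun i j => ?_
  simp only [Matrix.of_apply]
  split_ifs
  · exact contDiff_mulVec_apply _ (contDiff_phiVec_apply A C) i
  · exact contDiff_mulVec_apply _ (contDiff_psiVec_apply A T C) i

theorem bilinearSystem_solution {m : ℕ} {δ : ℂ} (hδ : δ ^ 2 = 1)
    {A T : Matrix (Fin (m + 1 + (m + 1))) (Fin (m + 1 + (m + 1))) ℂ}
    (C : Vec (m + 1 + (m + 1))) (hA : IsUnit A) (hAT : Commute A T) (hT : T ^ 2 = δ • 1) :
    BilinearSystem (-(Complex.I * δ)) (fSol (m + 1) A T C) (gSol (m + 1) A T C)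
      (reversed (fSol (m + 1) A T C)) (reversed (gSol (m + 1) A T C)) := by
  obtain ⟨α, hα⟩ := exists_hasDerivAt_det_exp (genX A) (-1)
  obtain ⟨β, hβ⟩ := exists_hasDerivAt_det_exp (genT A) 1
  have hd : ∀ x t : ℝ, (flow A (-x) t).det
      = (NormedSpace.exp ((-1 * (x : ℂ)) • genX A)).det
        * (NormedSpace.exp ((1 * (t : ℂ)) • genT A)).det := fun x t => by
    have e1 : NormedSpace.exp ((-1 * (x : ℂ)) • genX A) = flow A (-x) 0 := by simp [flow]
    have e2 : NormedSpace.exp ((1 * (t : ℂ)) • genT A) = flow A 0 t := by simp [flow]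
    rw [e1, e2, ← Matrix.det_mul, flow_mul_flow hA, add_zero, zero_add]
  have hpa := fun x k => mulVec_pCol (A := A) C x k
  have hqa := fun t k => mulVec_qCol (A := A) (T := T) C t k
  have B := ((bilinearSystem_wedge m (hasDerivAt_pCol (A := A) C)
    (hasDerivAt_qCol (T := T) C hA) hpa hqa).gauge hα hβ).const_mul
    (c' := -(Complex.I * δ))
    -- These are the constants relating reversed f and g to h and k. Their ratio γ/γ' is formally
    -- -2iδ, which turns the coefficient 1/2 into -iδ.
    (γ := (T * A⁻¹).det * ((-(δ * (-2 * Complex.I))) ^ (m + 1) * (genX A).det))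
    (γ' := (T * A⁻¹).det * (-(δ ^ 2 * (-(δ * (-2 * Complex.I))) ^ m) * (genX A).det)) (by
      rw [hδ, pow_succ]; ring)
  convert! B using 1
  · funext x t
    rw [fSol, wronskianF, doubleWronskian_eq_gauge C hA hAT rfl, hd]
  · funext x t
    rw [gSol, wronskianG, doubleWronskian_eq_gauge C hA hAT (b := m) (by omega), hd]
  · funext x t
    rw [reversed, fSol, wronskianF, doubleWronskian_reversed C hδ hA hAT hT rfl,
      vol_reversal_balanced (hpa x) (hqa t), hd]
    ring
  · funext x t
    rw [reversed, gSol, wronskianG, doubleWronskian_reversed C hδ hA hAT hT (b := m) (by omega),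
      vol_reversal_unbalanced (hpa x) (hqa t), hd]
    ring

theorem blockDiag_mul {N : ℕ} (P Q P' Q' : Matrix (Fin N) (Fin N) ℂ) :
    blockDiag P Q * blockDiag P' Q' = blockDiag (P * P') (Q * Q') := by
  simp only [blockDiag, Matrix.reindex_apply, Matrix.submatrix_mul_equiv, Matrix.fromBlocks_multiply]
  simp

theorem blockDiag_smul_one {N : ℕ} (c : ℂ) :
    blockDiag (c • (1 : Matrix (Fin N) (Fin N) ℂ)) (c • 1) = c • 1 := by
  have : Matrix.fromBlocks (c • (1 : Matrix (Fin N) (Fin N) ℂ)) 0 0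
      (c • (1 : Matrix (Fin N) (Fin N) ℂ)) = c • 1 := by
    rw [← Matrix.fromBlocks_one, Matrix.fromBlocks_smul]
    simp
  rw [blockDiag, this]
  ext i j
  simp [Matrix.one_apply]

theorem isUnit_blockDiag {N : ℕ} {P Q : Matrix (Fin N) (Fin N) ℂ} (hP : IsUnit P)
    (hQ : IsUnit Q) : IsUnit (blockDiag P Q) := by
  rw [Matrix.isUnit_iff_isUnit_det] at hP hQ ⊢
  rw [blockDiag, Matrix.reindex_apply, Matrix.det_submatrix_equiv_self,
    Matrix.det_fromBlocks_zero₂₁]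
  exact hP.mul hQ

end FokasLenells

theorem theorem22 (N : ℕ) (hN : 1 ≤ N) (δ : ℂ) (hδ : δ = 1 ∨ δ = -1) :
    (∀ (A T : Matrix (Fin (N + N)) (Fin (N + N)) ℂ) (C : Fin (N + N) → ℂ),
      IsUnit A → IsUnit T → A * T = T * A → T ^ 2 = δ • 1 →
        -- `f` and `g` are smooth, and so is `u` wherever `f` does not vanish
        ContDiff ℝ ∞ (fun p : ℝ × ℝ => fSol N A T C p.1 p.2) ∧
        ContDiff ℝ ∞ (fun p : ℝ × ℝ => gSol N A T C p.1 p.2) ∧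
        (∀ x t : ℝ, fSol N A T C x t ≠ 0 →
          ContDiffAt ℝ ∞ (fun p : ℝ × ℝ => uSol N A T C p.1 p.2) (x, t)) ∧
        -- the nonlocal equation, wherever `u(x,t)` and `u(-x,-t)` are defined
        (∀ x t : ℝ, fSol N A T C x t ≠ 0 → fSol N A T C (-x) (-t) ≠ 0 →
          pdt (pdx (uSol N A T C)) x t + uSol N A T C x t
            - 2 * Complex.I * δ * uSol N A T C x t * uSol N A T C (-x) (-t)
              * pdx (uSol N A T C) x t = 0) ∧
        -- the bilinear equations
        (∀ x t : ℝ,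
          hirota 1 1 (gSol N A T C) (fSol N A T C) x t
            + gSol N A T C x t * fSol N A T C x t = 0) ∧
        (∀ x t : ℝ,
          hirota 1 1 (fSol N A T C) (reversed (fSol N A T C)) x t
            + Complex.I * δ * hirota 1 0 (gSol N A T C) (reversed (gSol N A T C)) x t = 0) ∧
        (∀ x t : ℝ,
          hirota 0 1 (fSol N A T C) (reversed (fSol N A T C)) x t
            + Complex.I * δ * (gSol N A T C x t * gSol N A T C (-x) (-t)) = 0)) ∧
    -- the special solution of the matrix equations, for either square root `r` of `δ`
    (∀ (K H : Matrix (Fin N) (Fin N) ℂ) (r : ℂ), r ^ 2 = δ →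
      blockDiag K H * blockDiag (r • 1) (-(r • 1)) =
          blockDiag (r • 1) (-(r • 1)) * blockDiag K H ∧
        blockDiag (r • (1 : Matrix (Fin N) (Fin N) ℂ)) (-(r • 1)) ^ 2 = δ • 1 ∧
        IsUnit (blockDiag (r • (1 : Matrix (Fin N) (Fin N) ℂ)) (-(r • 1))) ∧
        (IsUnit K → IsUnit H → IsUnit (blockDiag K H))) := by
  have hδ2 : δ ^ 2 = 1 := by rcases hδ with rfl | rfl <;> norm_num
  refine ⟨fun A T C hA _ hAT hT => ?_, fun K H r hr => ⟨?_, ?_, ?_, isUnit_blockDiag⟩⟩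
  -- With N = m + 1 the second block of g has m columns, without truncated subtraction.
  · obtain ⟨m, rfl⟩ : ∃ m, N = m + 1 := ⟨N - 1, by omega⟩
    have B := bilinearSystem_solution hδ2 C hA hAT hT
    have cf : ContDiff ℝ ∞ (fun p : ℝ × ℝ => fSol (m + 1) A T C p.1 p.2) :=
      contDiff_doubleWronskian C hA hAT _ _ _
    have cg : ContDiff ℝ ∞ (fun p : ℝ × ℝ => gSol (m + 1) A T C p.1 p.2) :=
      contDiff_doubleWronskian C hA hAT _ _ _
    refine ⟨cf, cg, fun x t h => ?_, fun x t h h' => ?_,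
      fun x t => (B.hirota x t).1, fun x t => ?_, fun x t => ?_⟩
    · simp only [uSol, div_eq_mul_inv]
      exact cg.contDiffAt.mul (cf.contDiffAt.inv h)
    · have h1 := B.quotient h h'
      change pdt (pdx (uSol (m + 1) A T C)) x t + uSol (m + 1) A T C x t
        + 2 * -(Complex.I * δ) * uSol (m + 1) A T C x t * uSol (m + 1) A T C (-x) (-t)
          * pdx (uSol (m + 1) A T C) x t = 0 at h1
      linear_combination h1
    · linear_combination (B.hirota x t).2.1
    · have h1 := (B.hirota x t).2.2
      change _ - _ * (gSol (m + 1) A T C x t * gSol (m + 1) A T C (-x) (-t)) = 0 at h1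
      linear_combination h1
  · simp [blockDiag_mul]
  · rw [pow_two, blockDiag_mul, ← hr, ← blockDiag_smul_one]
    congr 1 <;> simp [smul_smul, pow_two]
  · have hr0 : r ≠ 0 := by
      rintro rfl
      rcases hδ with rfl | rfl <;> norm_num at hr
    have hu : IsUnit (r • (1 : Matrix (Fin N) (Fin N) ℂ)) := by
      rw [Matrix.isUnit_iff_isUnit_det]
      simp [hr0]
    exact isUnit_blockDiag hu hu.neg
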